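/- Let $\pi_1,\pi_2\in(0,1)$ be fixed. Consider a sequence of random $2\times 2$ contingency tables with counts $n_{ij}$ ($i,j\in\{1,2\}$), where row 1 counts the successes and row 2 the failures, and the columns are two groups. The column totals $n_{\cdot j}=n_{1j}+n_{2j}$ are non-random, and for each table $n_{11}$ and $n_{12}$ are independent with $n_{11}\sim \mathrm{Bi}(n_{\cdot 1},\pi_1)$ and $n_{12}\sim \mathrm{Bi}(n_{\cdot 2},\pi_2)$. Write $n_{i\cdot}=n_{i1}+n_{i2}$ for the row totals and $n=n_{\cdot 1}+n_{\cdot 2}$. Let $\lambda\neq 0$ be a fixed real number (for instance $\lambda\in(0,1]$), put $$\pi_1^*=\lambda\,\frac{n_{11}}{n_{\cdot 1}}+(1-\lambda)\,\frac{n_{1\cdot}}{n},\qquad \pi_2^*=\lambda\,\frac{n_{12}}{n_{\cdot 2}}+(1-\lambda)\,\frac{n_{1\cdot}}{n},$$ and let $$Z^*=(\pi_2^*-\pi_1^*)\sqrt{\frac{n\,n_{\cdot 1}\,n_{\cdot 2}}{n_{1\cdot}\,n_{2\cdot}}}$$ (with $Z^*=0$ if $n_{1\cdot}=0$ or $n_{2\cdot}=0$).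 If the null hypothesis $H_0:\pi_1=\pi_2$ holds, then, as $n_{\cdot 1}\to\infty$ and $n_{\cdot 2}\to\infty$, $$\frac{Z^*}{\lambda}=\frac{\pi_2^*-\pi_1^*}{\lambda}\sqrt{\frac{n\,n_{\cdot 1}\,n_{\cdot 2}}{n_{1\cdot}\,n_{2\cdot}}}\ \longrightarrow\ \Xi\quad\text{in distribution},\qquad \Xi\sim \mathrm{N}(0,1).$$ -/

import Mathlib

open MeasureTheory ProbabilityTheory Filter

/-- A `2 × 2` contingency table of observed counts. The columns are the two groups;
the first row counts the successes, the second row the failures. -/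
structure ContingencyTable where
  n11 : ℕ
  n12 : ℕ
  n21 : ℕ
  n22 : ℕ

namespace ContingencyTable

/-- Total number of successes `n_{1·}`. -/
def row1 (T : ContingencyTable) : ℕ := T.n11 + T.n12

/-- Total number of failures `n_{2·}`. -/
def row2 (T : ContingencyTable) : ℕ := T.n21 + T.n22

/-- Size `n_{·1}` of the first group. -/
def col1 (T : ContingencyTable) : ℕ := T.n11 + T.n21

/-- Size `n_{·2}` of the second group. -/
def col2 (T : ContingencyTable) : ℕ := T.n12 + T.n22

/-- Total number of observations `n`. -/
def total (T : ContingencyTable) : ℕ := T.n11 + T.n12 + T.n21 + T.n22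

/-- Maximum likelihood estimate of the success probability in the first group. -/
noncomputable def mle1 (T : ContingencyTable) : ℝ := (T.n11 : ℝ) / T.col1

/-- Maximum likelihood estimate of the success probability in the second group. -/
noncomputable def mle2 (T : ContingencyTable) : ℝ := (T.n12 : ℝ) / T.col2

/-- Pooled success rate `n_{1·} / n`. -/
noncomputable def pooled (T : ContingencyTable) : ℝ := (T.row1 : ℝ) / T.total

/-- Shrunken estimate `π₁*` with weight `lam`. -/
noncomputable def shrunk1 (lam : ℝ) (T : ContingencyTable) : ℝ :=
  lam * T.mle1 + (1 - lam) * T.pooled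

/-- Shrunken estimate `π₂*` with weight `lam`. -/
noncomputable def shrunk2 (lam : ℝ) (T : ContingencyTable) : ℝ :=
  lam * T.mle2 + (1 - lam) * T.pooled

/-- The homogeneity statistic evaluated with estimates `e₁`, `e₂` of the two success probabilities:
`(e₂ - e₁) √(n n_{·1} n_{·2} / (n_{1·} n_{2·}))`. For `e₁ = mle1` and `e₂ = mle2` it is Pearson's
`Z`. If `n_{1·} = 0` or `n_{2·} = 0` the quotient under the root is `0` by convention, and so is
the statistic. -/
noncomputable def homogeneityStat (e₁ e₂ : ℝ) (T : ContingencyTable) : ℝ :=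
  (e₂ - e₁) * √(((T.total : ℝ) * T.col1 * T.col2) / ((T.row1 : ℝ) * T.row2))

/-- The regularized statistic `Z*`: the homogeneity statistic with the shrunken estimates. -/
noncomputable def Zstar (lam : ℝ) (T : ContingencyTable) : ℝ :=
  homogeneityStat (T.shrunk1 lam) (T.shrunk2 lam) T

end ContingencyTable

/-- The random table `T` has (fixed) column totals `N₁`, `N₂`, and its two columns are independent
and binomial: the numbers of successes are `Bi(N₁, p₁)` and `Bi(N₂, p₂)`. -/
structure IsTwoBinomialTable {Ω : Type*} [MeasurableSpace Ω] (P : Measure Ω)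
    (T : Ω → ContingencyTable) (N₁ N₂ : ℕ) (p₁ p₂ : unitInterval) : Prop where
  col1_eq : ∀ᵐ ω ∂P, (T ω).col1 = N₁
  col2_eq : ∀ᵐ ω ∂P, (T ω).col2 = N₂
  law1 : HasLaw (fun ω => (T ω).n11) (binomial N₁ p₁) P
  law2 : HasLaw (fun ω => (T ω).n12) (binomial N₂ p₂) P
  indep : IndepFun (fun ω => (T ω).n11) (fun ω => (T ω).n12) P

open scoped Topology

/-! The pooled terms cancel in `π₂* - π₁*`, leaving `λ` times the difference of the raw frequencies,
so `Z* / λ` is Pearson's `Z`. `ContingencyTable.Zstar_div_eq` factors it as the difference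
standardized with the true `p`, times `√(p(1-p) / (p̂(1-p̂)))` with `p̂` the pooled rate. The first
factor is asymptotically normal (`tendstoInDistribution_binomial_linear_combination`, by
characteristic functions): its variance is exactly 1 and both coefficients vanish, so the group
sizes may grow at unrelated rates. The second tends to 1 in probability by Chebyshev
(`tendsto_measure_le_norm_comp_pooled_sub`), and Slutsky's theorem combines them. -/

/-! ### Characteristic functions of centred binomials -/

/-- The characteristic function of a centred Bernoulli variable with success probability `p`. -/
noncomputable def centeredBernoulliCharFun (p s : ℝ) : ℂ :=
  p * Complex.exp (s * (1 - p) * Complex.I) + (1 - p) * Complex.exp (-(s * p) * Complex.I)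

lemma norm_centeredBernoulliCharFun_le_one {p : ℝ} (h0 : 0 ≤ p) (h1 : p ≤ 1) (s : ℝ) :
    ‖centeredBernoulliCharFun p s‖ ≤ 1 := by
  have e1 : ‖Complex.exp (s * (1 - p) * Complex.I)‖ = 1 := by
    have := Complex.norm_exp_ofReal_mul_I (s * (1 - p))
    push_cast at this
    exact this
  have e2 : ‖Complex.exp (-(s * p) * Complex.I)‖ = 1 := by
    have := Complex.norm_exp_ofReal_mul_I (-(s * p))
    push_cast at this
    exact this
  have e3 : ‖(1 - p : ℂ)‖ = 1 - p := by
    rw [← Complex.ofReal_one, ← Complex.ofReal_sub, Complex.norm_real, Real.norm_of_nonneg]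
    linarith
  refine (norm_add_le _ _).trans ?_
  rw [norm_mul, norm_mul, e1, e2, e3, Complex.norm_real, Real.norm_of_nonneg h0]
  linarith

/-- The binomial theorem, once the phase of the outcome `k` is split into `k` successes and `n - k`
failures. -/
lemma charFun_map_centered_binomial {Ω : Type*} [MeasurableSpace Ω] {P : Measure Ω}
    {X : Ω → ℕ} {n : ℕ} {p : unitInterval} (hX : HasLaw X (binomial n p) P) (c t : ℝ) :
    charFun (P.map fun ω ↦ c * ((X ω : ℝ) - n * p)) t =
      centeredBernoulliCharFun p (c * t) ^ n := by
  have hm : AEMeasurable (fun ω ↦ c * ((X ω : ℝ) - n * p)) P :=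
    (measurable_of_countable fun k : ℕ ↦ c * ((k : ℝ) - n * p)).comp_aemeasurable hX.aemeasurable
  rw [charFun_apply_real, integral_map hm (by fun_prop)]
  have h := hX.integral_comp (f := fun k : ℕ ↦
    Complex.exp (t * (c * ((k : ℝ) - n * (p : ℝ)) : ℝ) * Complex.I))
    (measurable_of_countable _).aestronglyMeasurable
  simp only [Function.comp_def] at h
  rw [h, integral_binomial, centeredBernoulliCharFun, add_pow, ← Nat.range_succ_eq_Iic]
  refine Finset.sum_congr rfl fun k hk ↦ ?_
  have hk' : k ≤ n := Nat.lt_succ_iff.1 (Finset.mem_range.1 hk)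
  have key : Complex.exp (t * (c * ((k : ℝ) - n * (p : ℝ)) : ℝ) * Complex.I) =
      Complex.exp ((c * t : ℝ) * (1 - (p : ℝ)) * Complex.I) ^ k *
        Complex.exp (-((c * t : ℝ) * (p : ℝ)) * Complex.I) ^ (n - k) := by
    rw [← Complex.exp_nat_mul, ← Complex.exp_nat_mul, ← Complex.exp_add, Nat.cast_sub hk']
    congr 1
    push_cast
    ring
  rw [key, Complex.real_smul, mul_pow, mul_pow]
  push_cast
  ring

/-- Both Taylor expansions begin `1 - p(1-p)s²/2`: centring removes the linear term, and the
variance is `p(1-p)² + (1-p)p² = p(1-p)`. -/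
lemma centeredBernoulliCharFun_sub_exp_isLittleO (p : ℝ) :
    (fun s : ℝ ↦ centeredBernoulliCharFun p s - Complex.exp (-(p * (1 - p) * s ^ 2 / 2)))
      =o[𝓝 0] fun s : ℝ ↦ s ^ 2 := by
  have cubic (z : ℂ) : (fun s : ℝ ↦ Complex.exp (s * z) -
      ∑ i ∈ Finset.range 3, (s * z) ^ i / (i.factorial : ℂ)) =o[𝓝 0] fun s : ℝ ↦ s ^ 2 := by
    have ht : Tendsto (fun s : ℝ ↦ (s : ℂ) * z) (𝓝 0) (𝓝 0) :=
      Continuous.tendsto' (by fun_prop) _ _ (by simp)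
    refine ((Complex.exp_sub_sum_range_isBigO_pow 3).comp_tendsto ht).trans_isLittleO ?_
    have h1 : (fun s : ℝ ↦ ((s : ℂ) * z) ^ 3) =O[𝓝 0] fun s : ℝ ↦ s ^ 3 :=
      .of_bound (‖z‖ ^ 3) (.of_forall fun s ↦ by simp [mul_pow, mul_comm])
    exact h1.trans_isLittleO (Asymptotics.isLittleO_pow_pow (by norm_num))
  have quartic : (fun s : ℝ ↦ Complex.exp (-(p * (1 - p) * s ^ 2 / 2)) -
      ∑ i ∈ Finset.range 2, (-(p * (1 - p) * s ^ 2 / 2) : ℂ) ^ i / (i.factorial : ℂ))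
      =o[𝓝 0] fun s : ℝ ↦ s ^ 2 := by
    have ht : Tendsto (fun s : ℝ ↦ (-(p * (1 - p) * s ^ 2 / 2) : ℂ)) (𝓝 0) (𝓝 0) :=
      Continuous.tendsto' (by fun_prop) _ _ (by simp)
    refine ((Complex.exp_sub_sum_range_isBigO_pow 2).comp_tendsto ht).trans_isLittleO ?_
    have h1 : (fun s : ℝ ↦ (-(p * (1 - p) * s ^ 2 / 2) : ℂ) ^ 2) =O[𝓝 0] fun s : ℝ ↦ s ^ 4 := by
      refine .of_bound (‖(p * (1 - p) / 2 : ℂ)‖ ^ 2) (.of_forall fun s ↦ le_of_eq ?_)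
      rw [show (-(p * (1 - p) * s ^ 2 / 2) : ℂ) ^ 2 = (p * (1 - p) / 2) ^ 2 * (s : ℂ) ^ 4 by ring]
      simp
    exact h1.trans_isLittleO (Asymptotics.isLittleO_pow_pow (by norm_num))
  have h := ((cubic ((1 - p) * Complex.I)).const_mul_left (p : ℂ)).add
    ((cubic (-p * Complex.I)).const_mul_left (1 - p : ℂ)) |>.sub quartic
  refine h.congr_left fun s ↦ ?_
  have r1 : (s : ℂ) * ((1 - p) * Complex.I) = s * (1 - p) * Complex.I := by ring
  have r2 : (s : ℂ) * (-p * Complex.I) = -(s * p) * Complex.I := by ring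
  simp only [r1, r2, centeredBernoulliCharFun, Finset.sum_range_succ, Finset.sum_range_zero]
  simp only [Nat.factorial, mul_pow, Complex.I_sq]
  push_cast
  ring

/-- Factors are exchanged one at a time; those left over have norm at most 1, so the errors merely
add up. -/
lemma norm_pow_mul_pow_sub_le {R : Type*} [NormedCommRing R] [NormOneClass R] {a b c d : R}
    (ha : ‖a‖ ≤ 1) (hb : ‖b‖ ≤ 1) (hc : ‖c‖ ≤ 1) (hd : ‖d‖ ≤ 1) (m n : ℕ) :
    ‖a ^ m * b ^ n - c ^ m * d ^ n‖ ≤ m * ‖a - c‖ + n * ‖b - d‖ := by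
  have hpow {x : R} (hx : ‖x‖ ≤ 1) (k : ℕ) : ‖x ^ k‖ ≤ 1 :=
    (norm_pow_le x k).trans (pow_le_one₀ (norm_nonneg _) hx)
  have hsub {x y : R} (hx : ‖x‖ ≤ 1) (hy : ‖y‖ ≤ 1) (k : ℕ) : ‖x ^ k - y ^ k‖ ≤ k * ‖x - y‖ := by
    induction k with
    | zero => simp
    | succ k ih =>
      have : x ^ (k + 1) - y ^ (k + 1) = (x ^ k - y ^ k) * x + y ^ k * (x - y) := by ring
      rw [this]
      calc ‖(x ^ k - y ^ k) * x + y ^ k * (x - y)‖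
          ≤ ‖x ^ k - y ^ k‖ * ‖x‖ + ‖y ^ k‖ * ‖x - y‖ :=
            (norm_add_le _ _).trans (add_le_add (norm_mul_le _ _) (norm_mul_le _ _))
        _ ≤ (k * ‖x - y‖) * 1 + 1 * ‖x - y‖ := by
            gcongr
            exact hpow hy k
        _ = (k + 1 : ℕ) * ‖x - y‖ := by push_cast; ring
  have : a ^ m * b ^ n - c ^ m * d ^ n = (a ^ m - c ^ m) * b ^ n + c ^ m * (b ^ n - d ^ n) := by
    ring
  rw [this]
  calc ‖(a ^ m - c ^ m) * b ^ n + c ^ m * (b ^ n - d ^ n)‖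
      ≤ ‖a ^ m - c ^ m‖ * ‖b ^ n‖ + ‖c ^ m‖ * ‖b ^ n - d ^ n‖ :=
        (norm_add_le _ _).trans (add_le_add (norm_mul_le _ _) (norm_mul_le _ _))
    _ ≤ (m * ‖a - c‖) * 1 + 1 * (n * ‖b - d‖) := by
        gcongr
        exacts [hsub ha hc m, hpow hb n, hpow hc m, hsub hb hd n]
    _ = _ := by ring

/-- Products of powers of the characteristic function of a centred Bernoulli variable converge
to the characteristic function of a Gaussian when the arguments vanish and the variances match. -/
lemma tendsto_centeredBernoulliCharFun_pow_mul_pow {p : ℝ} (h0 : 0 ≤ p) (h1 : p ≤ 1)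
    {a b : ℕ → ℝ} {m n : ℕ → ℕ} {v : ℝ} (ha : Tendsto a atTop (𝓝 0)) (hb : Tendsto b atTop (𝓝 0))
    (hv : ∀ᶠ k in atTop, m k * a k ^ 2 + n k * b k ^ 2 = v) :
    Tendsto (fun k ↦ centeredBernoulliCharFun p (a k) ^ m k * centeredBernoulliCharFun p (b k) ^ n k)
      atTop (𝓝 (Complex.exp (-(p * (1 - p) * v / 2)))) := by
  have hv0 : 0 ≤ v := by
    obtain ⟨k, hk⟩ := hv.exists
    rw [← hk]
    positivity
  have gauss (s : ℝ) : ‖Complex.exp (-(p * (1 - p) * s ^ 2 / 2))‖ ≤ 1 := by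
    rw [Complex.norm_exp, Real.exp_le_one_iff]
    have : (-(p * (1 - p) * s ^ 2 / 2) : ℂ).re = -(p * (1 - p) * s ^ 2 / 2) := by
      norm_cast
    rw [this]
    have := mul_nonneg h0 (sub_nonneg.2 h1)
    have := mul_nonneg this (sq_nonneg s)
    linarith
  rw [Metric.tendsto_nhds]
  intro ε hε
  -- The total error will be at most `ε v / (v + 1)`; the `+ 1` makes this strictly less than `ε`
  -- and also covers `v = 0`.
  have hδ : 0 < ε / (v + 1) := by positivity
  have ho := (centeredBernoulliCharFun_sub_exp_isLittleO p).def hδ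
  filter_upwards [hv, ha.eventually ho, hb.eventually ho] with k hk hak hbk
  have e : Complex.exp (-(p * (1 - p) * v / 2)) =
      Complex.exp (-(p * (1 - p) * (a k) ^ 2 / 2)) ^ m k *
        Complex.exp (-(p * (1 - p) * (b k) ^ 2 / 2)) ^ n k := by
    rw [← Complex.exp_nat_mul, ← Complex.exp_nat_mul, ← Complex.exp_add, ← hk]
    congr 1
    push_cast
    ring
  rw [dist_eq_norm, e]
  rw [norm_pow, Real.norm_eq_abs, sq_abs] at hak hbk
  calc _ ≤ _ := norm_pow_mul_pow_sub_le (norm_centeredBernoulliCharFun_le_one h0 h1 _)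
          (norm_centeredBernoulliCharFun_le_one h0 h1 _) (gauss _) (gauss _) _ _
    _ ≤ m k * (ε / (v + 1) * a k ^ 2) + n k * (ε / (v + 1) * b k ^ 2) := by gcongr
    _ = ε / (v + 1) * (m k * a k ^ 2 + n k * b k ^ 2) := by ring
    _ = ε * (v / (v + 1)) := by rw [hk]; ring
    _ < ε * 1 := by
        gcongr
        rw [div_lt_one (by positivity)]
        linarith
    _ = ε := mul_one ε

/-! ### Slutsky's theorem on varying spaces -/

lemma AEMeasurable.of_natCast_comp {Ω : Type*} [MeasurableSpace Ω] {P : Measure Ω} {X : Ω → ℕ}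
    (hX : AEMeasurable X P) (f : ℕ → ℝ) : AEMeasurable (fun ω ↦ f (X ω)) P :=
  (measurable_of_countable f).comp_aemeasurable hX

/-- **Slutsky's theorem** for products, with the variables living on varying probability spaces. -/
lemma tendstoInDistribution_mul_of_tendsto_measure {Ω : ℕ → Type*} [∀ k, MeasurableSpace (Ω k)]
    {P : ∀ k, Measure (Ω k)} [∀ k, IsProbabilityMeasure (P k)]
    {Ω' : Type*} [MeasurableSpace Ω'] {P' : Measure Ω'} [IsProbabilityMeasure P']
    {X Y : ∀ k, Ω k → ℝ} {Z : Ω' → ℝ} {c : ℝ} (hX : TendstoInDistribution X atTop Z P P')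
    (hYm : ∀ k, AEMeasurable (Y k) (P k))
    (hY : ∀ ε > 0, Tendsto (fun k ↦ P k {ω | ε ≤ ‖Y k ω - c‖}) atTop (𝓝 0)) :
    TendstoInDistribution (fun k ω ↦ X k ω * Y k ω) atTop (fun ω ↦ Z ω * c) P P' := by
  -- Only the joint law of `X k` and `Y k` for each single `k` matters, so all pairs can be lifted
  -- to one infinite product space, where the fixed-space Slutsky theorem applies.
  have mp (k : ℕ) := measurePreserving_eval_infinitePi P k
  have map_eq {f : ∀ k, Ω k → ℝ} (hf : ∀ k, AEMeasurable (f k) (P k)) (k : ℕ) :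
      (Measure.infinitePi P).map (fun ω ↦ f k (ω k)) = (P k).map (f k) := by
    have h := AEMeasurable.map_map_of_aemeasurable (μ := Measure.infinitePi P)
      (f := Function.eval k) (g := f k) (by rw [(mp k).map_eq]; exact hf k)
      (mp k).measurable.aemeasurable
    rw [(mp k).map_eq] at h
    exact h.symm
  have lift {f : ∀ k, Ω k → ℝ} (hf : ∀ k, AEMeasurable (f k) (P k)) (k : ℕ) :
      AEMeasurable (fun ω : ∀ k, Ω k ↦ f k (ω k)) (Measure.infinitePi P) :=
    AEMeasurable.comp_aemeasurable (by rw [(mp k).map_eq]; exact hf k)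
      (mp k).measurable.aemeasurable
  have hX' : TendstoInDistribution (fun k (ω : ∀ k, Ω k) ↦ X k (ω k)) atTop Z
      (fun _ ↦ Measure.infinitePi P) P' := by
    refine ⟨lift hX.forall_aemeasurable, hX.aemeasurable_limit, ?_⟩
    refine hX.tendsto.congr fun k ↦ ?_
    exact Subtype.ext (map_eq hX.forall_aemeasurable k).symm
  have hY' : TendstoInMeasure (Measure.infinitePi P) (fun k (ω : ∀ k, Ω k) ↦ Y k (ω k)) atTop
      fun _ ↦ c := by
    rw [tendstoInMeasure_iff_norm]
    intro ε hε
    refine (hY ε hε).congr fun k ↦ ?_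
    have hs : NullMeasurableSet {ω | ε ≤ ‖Y k ω - c‖} (P k) :=
      nullMeasurableSet_le aemeasurable_const ((hYm k).sub aemeasurable_const).norm
    exact ((mp k).measure_preimage hs).symm
  have h := hX'.continuous_comp_prodMk_of_tendstoInMeasure_const
    (g := fun x : ℝ × ℝ ↦ x.1 * x.2) (by fun_prop) hY' (lift hYm)
  have hm (k : ℕ) : AEMeasurable (fun ω ↦ X k ω * Y k ω) (P k) :=
    (hX.forall_aemeasurable k).mul (hYm k)
  refine ⟨hm, h.aemeasurable_limit, ?_⟩
  refine h.tendsto.congr fun k ↦ ?_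
  exact Subtype.ext (map_eq hm k)

/-! ### Law of large numbers for the pooled rate -/

/-- This is the variance identity for Bernstein polynomials, evaluated at `p`. -/
lemma integral_sq_sub_of_hasLaw_binomial {Ω : Type*} [MeasurableSpace Ω] {P : Measure Ω}
    {X : Ω → ℕ} {n : ℕ} {p : unitInterval} (hX : HasLaw X (binomial n p) P) :
    ∫ ω, ((X ω : ℝ) - n * p) ^ 2 ∂P = n * p * (1 - p) := by
  have h := hX.integral_comp (f := fun k : ℕ ↦ ((k : ℝ) - n * (p : ℝ)) ^ 2)
    (measurable_of_countable _).aestronglyMeasurable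
  simp only [Function.comp_def] at h
  rw [h, integral_binomial, ← Nat.range_succ_eq_Iic]
  have hv := congrArg (Polynomial.eval (p : ℝ)) (bernsteinPolynomial.variance ℝ n)
  simp only [Polynomial.eval_finsetSum, bernsteinPolynomial, nsmul_eq_mul, Polynomial.eval_mul,
    Polynomial.eval_pow, Polynomial.eval_sub, Polynomial.eval_natCast, Polynomial.eval_X,
    Polynomial.eval_one] at hv
  rw [← hv]
  refine Finset.sum_congr rfl fun k _ ↦ ?_
  rw [smul_eq_mul]
  ring

/-- Chebyshev's inequality for the relative frequency of successes. -/
lemma measureReal_le_abs_div_sub_of_hasLaw_binomial {Ω : Type*} [MeasurableSpace Ω]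
    {P : Measure Ω} {X : Ω → ℕ} {n : ℕ} {p : unitInterval} (hX : HasLaw X (binomial n p) P)
    (hn : 0 < n) {ε : ℝ} (hε : 0 < ε) :
    P.real {ω | ε ≤ |(X ω : ℝ) / n - p|} ≤ p * (1 - p) / ε ^ 2 / n := by
  have hn' : (0 : ℝ) < n := by exact_mod_cast hn
  have hint : Integrable (fun ω ↦ ((X ω : ℝ) - n * p) ^ 2) P := by
    have h := integrable_binomial (n := n) (p := p) fun k : ℕ ↦ ((k : ℝ) - n * (p : ℝ)) ^ 2
    rw [← hX.map_eq] at h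
    exact h.comp_aemeasurable hX.aemeasurable
  have h := mul_meas_ge_le_integral_of_nonneg (μ := P)
    (ae_of_all _ fun ω ↦ sq_nonneg ((X ω : ℝ) - n * p)) hint ((ε * n) ^ 2)
  rw [integral_sq_sub_of_hasLaw_binomial hX] at h
  have hset : {ω | (ε * n) ^ 2 ≤ ((X ω : ℝ) - n * p) ^ 2} = {ω | ε ≤ |(X ω : ℝ) / n - p|} := by
    ext ω
    have : (X ω : ℝ) / n - p = ((X ω : ℝ) - n * p) / n := by field_simp
    rw [Set.mem_ofPred_eq, Set.mem_ofPred_eq, this, abs_div, abs_of_pos hn', le_div_iff₀ hn',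
      sq_le_sq, abs_of_pos (mul_pos hε hn')]
  rw [hset] at h
  rw [div_div, le_div_iff₀ (by positivity)]
  refine le_of_mul_le_mul_left ?_ hn'
  linarith

lemma tendsto_measure_le_abs_div_sub_of_hasLaw_binomial {Ω : ℕ → Type*}
    [∀ k, MeasurableSpace (Ω k)] {P : ∀ k, Measure (Ω k)} [∀ k, IsProbabilityMeasure (P k)]
    {X : ∀ k, Ω k → ℕ} {N : ℕ → ℕ} {p : unitInterval}
    (hX : ∀ k, HasLaw (X k) (binomial (N k) p) (P k)) (hN : Tendsto N atTop atTop)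
    {ε : ℝ} (hε : 0 < ε) :
    Tendsto (fun k ↦ P k {ω | ε ≤ |(X k ω : ℝ) / N k - p|}) atTop (𝓝 0) := by
  suffices Tendsto (fun k ↦ (P k).real {ω | ε ≤ |(X k ω : ℝ) / N k - p|}) atTop (𝓝 0) by
    rw [← ENNReal.tendsto_toReal_iff (fun _ ↦ measure_ne_top _ _) ENNReal.zero_ne_top]
    simpa [Measure.real] using this
  refine squeeze_zero' (.of_forall fun _ ↦ measureReal_nonneg) ?_
    ((tendsto_natCast_atTop_atTop.comp hN).const_div_atTop ((p : ℝ) * (1 - p) / ε ^ 2))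
  filter_upwards [hN.eventually_gt_atTop 0] with k hk
  exact measureReal_le_abs_div_sub_of_hasLaw_binomial (hX k) hk hε

/-- The pooled success rate converges in probability to the common success probability, and so
do continuous transformations of it. -/
lemma tendsto_measure_le_norm_comp_pooled_sub {Ω : ℕ → Type*}
    [∀ k, MeasurableSpace (Ω k)] {P : ∀ k, Measure (Ω k)} [∀ k, IsProbabilityMeasure (P k)]
    {X Y : ∀ k, Ω k → ℕ} {M N : ℕ → ℕ} {p : unitInterval}
    (hX : ∀ k, HasLaw (X k) (binomial (M k) p) (P k))
    (hY : ∀ k, HasLaw (Y k) (binomial (N k) p) (P k))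
    (hM : Tendsto M atTop atTop) (hN : Tendsto N atTop atTop) {g : ℝ → ℝ}
    (hg : ContinuousAt g p) {ε : ℝ} (hε : 0 < ε) :
    Tendsto (fun k ↦ P k {ω | ε ≤ ‖g (((X k ω : ℝ) + Y k ω) / ((M k : ℝ) + N k)) - g p‖})
      atTop (𝓝 0) := by
  obtain ⟨δ, hδ, hgδ⟩ := Metric.continuousAt_iff.1 hg ε hε
  have hsum := (tendsto_measure_le_abs_div_sub_of_hasLaw_binomial hX hM hδ).add
    (tendsto_measure_le_abs_div_sub_of_hasLaw_binomial hY hN hδ)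
  rw [add_zero] at hsum
  refine tendsto_of_tendsto_of_tendsto_of_le_of_le' tendsto_const_nhds hsum
    (.of_forall fun _ ↦ zero_le) ?_
  filter_upwards [hM.eventually_gt_atTop 0, hN.eventually_gt_atTop 0] with k hk1 hk2
  refine (measure_mono ?_).trans (measure_union_le _ _)
  intro ω hω
  by_contra hcon
  simp only [Set.mem_union, Set.mem_ofPred_eq, not_or, not_le] at hcon
  refine absurd (hgδ ?_) (not_lt.2 hω)
  have h1 : (0 : ℝ) < M k := by exact_mod_cast hk1
  have h2 : (0 : ℝ) < N k := by exact_mod_cast hk2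
  -- The pooled deviation is a convex combination of the two group deviations, so it is below `δ`
  -- when both are.
  have e : ((X k ω : ℝ) + Y k ω) / ((M k : ℝ) + N k) - p =
      (M k * ((X k ω : ℝ) / M k - p) + N k * ((Y k ω : ℝ) / N k - p)) / ((M k : ℝ) + N k) := by
    field_simp
    ring
  rw [Real.dist_eq, e, abs_div, abs_of_pos (add_pos h1 h2), div_lt_iff₀ (add_pos h1 h2)]
  calc _ ≤ M k * |(X k ω : ℝ) / M k - p| + N k * |(Y k ω : ℝ) / N k - p| := by
          refine (abs_add_le _ _).trans_eq ?_
          rw [abs_mul, abs_mul, abs_of_pos h1, abs_of_pos h2]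
    _ < M k * δ + N k * δ := by
          gcongr
          exacts [hcon.1, hcon.2]
    _ = _ := by ring

/-! ### Central limit theorem -/

/-- **Central limit theorem** for linear combinations of two independent centred binomial
variables with the same success probability. -/
lemma tendstoInDistribution_binomial_linear_combination {Ω : ℕ → Type*}
    [∀ k, MeasurableSpace (Ω k)] {P : ∀ k, Measure (Ω k)} [∀ k, IsProbabilityMeasure (P k)]
    {Ω' : Type*} [MeasurableSpace Ω'] {P' : Measure Ω'} [IsProbabilityMeasure P']
    {X Y : ∀ k, Ω k → ℕ} {M N : ℕ → ℕ} {p : unitInterval}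
    (hX : ∀ k, HasLaw (X k) (binomial (M k) p) (P k))
    (hY : ∀ k, HasLaw (Y k) (binomial (N k) p) (P k))
    (hXY : ∀ k, IndepFun (X k) (Y k) (P k)) {a b : ℕ → ℝ}
    (ha : Tendsto a atTop (𝓝 0)) (hb : Tendsto b atTop (𝓝 0))
    (hab : ∀ᶠ k in atTop, (p : ℝ) * (1 - p) * (M k * a k ^ 2 + N k * b k ^ 2) = 1)
    {Z : Ω' → ℝ} (hZ : HasLaw Z (gaussianReal 0 1) P') :
    TendstoInDistribution
      (fun k ω ↦ a k * ((X k ω : ℝ) - M k * p) + b k * ((Y k ω : ℝ) - N k * p)) atTop Z P P' := by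
  have mX (k) := (hX k).aemeasurable.of_natCast_comp fun x ↦ a k * ((x : ℝ) - M k * p)
  have mY (k) := (hY k).aemeasurable.of_natCast_comp fun x ↦ b k * ((x : ℝ) - N k * p)
  have hpq : (p : ℝ) * (1 - p) ≠ 0 := by
    obtain ⟨k, hk⟩ := hab.exists
    exact left_ne_zero_of_mul_eq_one hk
  refine ⟨fun k ↦ (mX k).add (mY k), hZ.aemeasurable, ?_⟩
  refine ProbabilityMeasure.tendsto_iff_tendsto_charFun.2 fun t ↦ ?_
  have hlim := tendsto_centeredBernoulliCharFun_pow_mul_pow p.2.1 p.2.2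
    (a := fun k ↦ a k * t) (b := fun k ↦ b k * t) (m := M) (n := N)
    (v := t ^ 2 / (p * (1 - p))) (by simpa using ha.mul_const t) (by simpa using hb.mul_const t) (by
      filter_upwards [hab] with k hk
      rw [eq_div_iff hpq]
      linear_combination t ^ 2 * hk)
  have hval : Complex.exp (-((p : ℝ) * (1 - (p : ℝ)) * (t ^ 2 / (p * (1 - p)) : ℝ) / 2)) =
      charFun (P'.map Z) t := by
    have hpq' : ((p : ℝ) : ℂ) * (1 - (p : ℝ)) ≠ 0 := by exact_mod_cast hpq
    rw [hZ.map_eq, charFun_gaussianReal]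
    congr 1
    push_cast
    rw [mul_div_cancel₀ _ hpq']
    simp
  rw [hval] at hlim
  refine hlim.congr fun k ↦ ?_
  have hind : IndepFun (fun ω ↦ a k * ((X k ω : ℝ) - M k * p))
      (fun ω ↦ b k * ((Y k ω : ℝ) - N k * p)) (P k) :=
    (hXY k).comp (φ := fun x : ℕ ↦ a k * ((x : ℝ) - M k * p))
      (ψ := fun x : ℕ ↦ b k * ((x : ℝ) - N k * p))
      (measurable_of_countable _) (measurable_of_countable _)
  have := congrFun (hind.charFun_map_fun_add_eq_mul (mX k) (mY k)) t
  rw [Pi.mul_apply, charFun_map_centered_binomial (hX k), charFun_map_centered_binomial (hY k)]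
    at this
  exact this.symm

/-! ### Factorization of the statistic and conclusion -/

/-- On a table with column totals `N₁` and `N₂`, the statistic `Z* / λ` is a centred linear
combination of the success counts times a function of the pooled success rate. -/
lemma ContingencyTable.Zstar_div_eq (T : ContingencyTable) {lam p : ℝ} (hlam : lam ≠ 0)
    (h0 : 0 < p) (h1 : p < 1) {N₁ N₂ : ℕ} (hN₁ : T.col1 = N₁) (hN₂ : T.col2 = N₂) :
    T.Zstar lam / lam =
      (-(√((N₁ : ℝ) * N₂ / (((N₁ : ℝ) + N₂) * (p * (1 - p)))) / N₁) * ((T.n11 : ℝ) - N₁ * p) +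
        √((N₁ : ℝ) * N₂ / (((N₁ : ℝ) + N₂) * (p * (1 - p)))) / N₂ * ((T.n12 : ℝ) - N₂ * p)) *
      √(p * (1 - p) / (((T.n11 : ℝ) + T.n12) / ((N₁ : ℝ) + N₂) *
        (1 - ((T.n11 : ℝ) + T.n12) / ((N₁ : ℝ) + N₂)))) := by
  have hq : 0 < 1 - p := sub_pos.2 h1
  have htot : (T.total : ℝ) = N₁ + N₂ := by
    rw [← hN₁, ← hN₂]
    simp only [total, col1, col2]
    push_cast
    ring
  have hrow1 : (T.row1 : ℝ) = T.n11 + T.n12 := by simp [row1]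
  have hrow2 : (T.row2 : ℝ) = N₁ + N₂ - (T.n11 + T.n12) := by
    rw [← hN₁, ← hN₂]
    simp only [row2, col1, col2]
    push_cast
    ring
  have hdiff : T.Zstar lam / lam = ((T.n12 : ℝ) / N₂ - (T.n11 : ℝ) / N₁) *
      √(((N₁ : ℝ) + N₂) * N₁ * N₂ / (T.row1 * T.row2)) := by
    rw [Zstar, homogeneityStat, shrunk1, shrunk2, mle1, mle2, htot, hN₁, hN₂]
    field_simp
    ring
  rw [hdiff]
  rcases Nat.eq_zero_or_pos N₁ with rfl | hN₁'
  · simp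
  rcases Nat.eq_zero_or_pos N₂ with rfl | hN₂'
  · simp
  have c1 : (0 : ℝ) < N₁ := by exact_mod_cast hN₁'
  have c2 : (0 : ℝ) < N₂ := by exact_mod_cast hN₂'
  set D : ℝ := (N₁ : ℝ) * N₂ / (((N₁ : ℝ) + N₂) * (p * (1 - p))) with hD
  have hlin : -(√D / N₁) * ((T.n11 : ℝ) - N₁ * p) + √D / N₂ * ((T.n12 : ℝ) - N₂ * p) =
      ((T.n12 : ℝ) / N₂ - (T.n11 : ℝ) / N₁) * √D := by
    field_simp
    ring
  rw [hlin, mul_assoc _ √D, ← Real.sqrt_mul (by positivity)]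
  congr 2
  have hprod : ((T.n11 : ℝ) + T.n12) / ((N₁ : ℝ) + N₂) *
      (1 - ((T.n11 : ℝ) + T.n12) / ((N₁ : ℝ) + N₂)) =
      T.row1 * T.row2 / ((N₁ : ℝ) + N₂) ^ 2 := by
    rw [hrow1, hrow2]
    field_simp
  rw [hprod, hD]
  have := hq.ne'
  -- With an empty row, both radicands vanish because division by zero gives zero.
  rcases eq_or_ne ((T.row1 : ℝ) * T.row2) 0 with h | h
  · simp [h]
  · field_simp

/-- The coefficient of one of the two success counts in the standardized difference of the
success frequencies is asymptotically negligible. -/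
lemma tendsto_sqrt_harmonic_div {M N : ℕ → ℕ} (hM : Tendsto M atTop atTop) {c : ℝ} (hc : 0 < c) :
    Tendsto (fun k ↦ √((M k : ℝ) * N k / (((M k : ℝ) + N k) * c)) / M k) atTop (𝓝 0) := by
  -- This majorant comes from `N / (M + N) ≤ 1`, so no control of `N` is needed.
  have hlim : Tendsto (fun k ↦ √(1 / c / M k)) atTop (𝓝 0) := by
    simpa using ((tendsto_natCast_atTop_atTop.comp hM).const_div_atTop (1 / c)).sqrt
  refine squeeze_zero' (.of_forall fun _ ↦ by positivity) ?_ hlim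
  filter_upwards [hM.eventually_gt_atTop 0] with k hk
  have h1 : (0 : ℝ) < M k := by exact_mod_cast hk
  have h2 : (0 : ℝ) ≤ N k := Nat.cast_nonneg _
  rw [div_le_iff₀ h1]
  have hsq : √(1 / c / M k) * M k = √(1 / c / M k * (M k : ℝ) ^ 2) := by
    rw [Real.sqrt_mul (by positivity), Real.sqrt_sq h1.le]
  rw [hsq]
  apply Real.sqrt_le_sqrt
  rw [div_le_iff₀ (by positivity)]
  have : 1 / c / (M k : ℝ) * M k ^ 2 * (((M k : ℝ) + N k) * c) = M k * (M k + N k) := by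
    field_simp
  rw [this]
  nlinarith

theorem theorem6 {Ω : ℕ → Type*} [∀ k, MeasurableSpace (Ω k)]
    (P : ∀ k, Measure (Ω k)) [∀ k, IsProbabilityMeasure (P k)]
    {Ω' : Type*} [MeasurableSpace Ω'] (P' : Measure Ω') [IsProbabilityMeasure P']
    (T : ∀ k, Ω k → ContingencyTable) (N₁ N₂ : ℕ → ℕ) (p₁ p₂ : unitInterval)
    (hT : ∀ k, IsTwoBinomialTable (P k) (T k) (N₁ k) (N₂ k) p₁ p₂)
    (hN₁ : Tendsto N₁ atTop atTop) (hN₂ : Tendsto N₂ atTop atTop)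
    (hp_pos : 0 < p₁) (hp_lt : p₁ < 1)
    (lam : ℝ) (hlam : lam ≠ 0)
    (H0 : p₁ = p₂)
    (Ξ : Ω' → ℝ) (hΞ : HasLaw Ξ (gaussianReal 0 1) P') :
    TendstoInDistribution (fun k ω => (T k ω).Zstar lam / lam) atTop Ξ P P' := by
  subst H0
  have h0 : (0 : ℝ) < p₁ := hp_pos
  have h1 : (p₁ : ℝ) < 1 := hp_lt
  have hpq : 0 < (p₁ : ℝ) * (1 - p₁) := mul_pos h0 (sub_pos.2 h1)
  set D : ℕ → ℝ := fun k ↦ (N₁ k : ℝ) * N₂ k / (((N₁ k : ℝ) + N₂ k) * (p₁ * (1 - p₁))) with hD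
  have ha : Tendsto (fun k ↦ -(√(D k) / N₁ k)) atTop (𝓝 0) := by
    simpa using (tendsto_sqrt_harmonic_div (N := N₂) hN₁ hpq).neg
  have hb : Tendsto (fun k ↦ √(D k) / N₂ k) atTop (𝓝 0) :=
    (tendsto_sqrt_harmonic_div (N := N₁) hN₂ hpq).congr fun k ↦ by
      rw [hD, mul_comm (N₂ k : ℝ), add_comm (N₂ k : ℝ)]
  have hW := tendstoInDistribution_binomial_linear_combination (fun k ↦ (hT k).law1)
    (fun k ↦ (hT k).law2) (fun k ↦ (hT k).indep) ha hb (by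
      filter_upwards [hN₁.eventually_gt_atTop 0, hN₂.eventually_gt_atTop 0] with k hk1 hk2
      have c1 : (0 : ℝ) < N₁ k := by exact_mod_cast hk1
      have c2 : (0 : ℝ) < N₂ k := by exact_mod_cast hk2
      -- The variance is `p(1-p) D (1/N₁ + 1/N₂)`, and `D` is chosen to make it 1.
      rw [neg_sq, div_pow, div_pow, Real.sq_sqrt (by positivity), hD]
      have := (sub_pos.2 h1).ne'
      field_simp
      ring) hΞ
  have hg : ContinuousAt (fun x : ℝ ↦ √(p₁ * (1 - p₁) / (x * (1 - x)))) p₁ := by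
    have : (p₁ : ℝ) * (1 - p₁) ≠ 0 := hpq.ne'
    fun_prop (disch := assumption)
  have hV := tendstoInDistribution_mul_of_tendsto_measure hW (fun k ↦ by
      have hm : AEMeasurable (fun ω ↦ ((T k ω).n11 : ℝ) + (T k ω).n12) (P k) :=
        ((hT k).law1.aemeasurable.of_natCast_comp (↑·)).add
          ((hT k).law2.aemeasurable.of_natCast_comp (↑·))
      have hgm : Measurable fun x : ℝ ↦ √(p₁ * (1 - p₁) / (x * (1 - x))) := by fun_prop
      exact hgm.comp_aemeasurable (hm.div_const ((N₁ k : ℝ) + N₂ k)))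
    fun ε hε ↦ tendsto_measure_le_norm_comp_pooled_sub (fun k ↦ (hT k).law1)
      (fun k ↦ (hT k).law2) hN₁ hN₂ hg hε
  refine hV.congr (fun k ↦ ?_) (ae_of_all _ fun ω ↦ ?_)
  · filter_upwards [(hT k).col1_eq, (hT k).col2_eq] with ω h1' h2'
    exact ((T k ω).Zstar_div_eq hlam h0 h1 h1' h2').symm
  -- The Slutsky limit is `Ξ` times the value at `p` of the correction factor, which is 1.
  · simp [div_self hpq.ne']
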